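/- Varieties over a field $k$ are reduced separated schemes of finite type over $k$, and $X(K)$ denotes the set of $K$-points of a $k$-variety $X$ for a field extension $K/k$. A field $k$ (of any characteristic) is called \emph{large} if for every irreducible $k$-variety $Y$ having a smooth $k$-point, the set $Y(k)$ is Zariski dense in $Y$. For an irreducible $k$-variety $X$, a subset $D\subset X(\bar k)$ is called \emph{Zariski very dense} in $X$ if $D$ is not contained in a countable union of closed $k$-subvarieties $V_i\subsetneq X$. \textbf{Lemma.} Let $X$ be a smooth and irreducible variety over a large field $k$ such that $X(k)\neq\emptyset$. Then $X(k)$ is not contained in the union of fewer than $|k|$ closed $k$-subvarieties $X_\lambda\subsetneq X$; that is, if $\{X_\lambda\}_{\lambda\in\Lambda}$ is a family of closed $k$-subvarieties of $X$, each different from $X$, with $|\Lambda|<|k|$, then $X(k)\not\subset\bigcup_{\lambda\in\Lambda}X_\lambda$. In particular, if $k$ is uncountable, then $X(k)$ (viewed as a subset of $X(\bar k)$) is Zariski very dense in $X$. -/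

import Mathlib

open CategoryTheory AlgebraicGeometry Cardinal TopologicalSpace

universe u

noncomputable section

namespace LargeFieldVarieties

/-- The morphism `f : X ⟶ Spec k` makes `X` an algebraic variety over the field `k`
(not necessarily irreducible): a reduced separated scheme of finite type over `k`. -/
structure IsVariety {k : Type u} [Field k] {X : Scheme.{u}}
    (f : X ⟶ Spec (CommRingCat.of k)) : Prop where
  isReduced : IsReduced X
  isSeparated : IsSeparated f
  locallyOfFiniteType : LocallyOfFiniteType f
  quasiCompact : QuasiCompact f

/-- The set `X(K)` of `K`-points of the `k`-scheme `f : X ⟶ Spec k`, for an extension `K` of `k`: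
the morphisms `Spec K ⟶ X` over `Spec k`. -/
@[ext]
structure Point {k : Type u} [Field k] {X : Scheme.{u}} (f : X ⟶ Spec (CommRingCat.of k))
    (K : Type u) [Field K] [Algebra k K] : Type u where
  hom : Spec (CommRingCat.of K) ⟶ X
  hom_comp : hom ≫ f = Spec.map (CommRingCat.ofHom (algebraMap k K))

namespace Point

variable {k : Type u} [Field k] {X : Scheme.{u}} {f : X ⟶ Spec (CommRingCat.of k)}
  {K : Type u} [Field K] [Algebra k K]

/-- The point of the underlying topological space of `X` at which a `K`-point is supported.
A `K`-point of `X` is a `K`-point of a reduced closed subscheme `V` of `X` if and only if it is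
supported at a point of `V`. -/
def support (x : Point f K) : X :=
  x.hom (IsLocalRing.closedPoint K)

/-- The inclusion `X(k) ⊆ X(K)`. -/
def baseChange (K : Type u) [Field K] [Algebra k K] (x : Point f k) : Point f K :=
  ⟨Spec.map (CommRingCat.ofHom (algebraMap k K)) ≫ x.hom, by
    rw [Category.assoc, x.hom_comp, ← Spec.map_comp, ← CommRingCat.ofHom_comp,
      Algebra.algebraMap_self, RingHom.comp_id]⟩

end Point

/-- The `k`-scheme `f : X ⟶ Spec k` is smooth over `k` at the point `x`. -/
def IsSmoothAtPoint {k : Type u} [Field k] {X : Scheme.{u}} (f : X ⟶ Spec (CommRingCat.of k))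
    (x : X) : Prop :=
  ∃ U : X.Opens, x ∈ U ∧ Smooth (U.ι ≫ f)

/-- A field `k` is large if for every irreducible `k`-variety `Y` that has a smooth `k`-point,
the set `Y(k)` is Zariski dense in `Y`. -/
def IsLargeField (k : Type u) [Field k] : Prop :=
  ∀ (Y : Scheme.{u}) (g : Y ⟶ Spec (CommRingCat.of k)), IsVariety g → IrreducibleSpace Y →
    (∃ y : Point g k, IsSmoothAtPoint g y.support) →
      Dense (Set.range fun y : Point g k => y.support)

/-- A subset `D` of the set `X(k̄)` of geometric points of a `k`-variety `X` is Zariski very dense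
if it is not contained in a countable union of closed `k`-subvarieties of `X` different from `X`.
The closed `k`-subvarieties of `X` are given by the closed subsets of the scheme `X`. -/
def IsZariskiVeryDense {k : Type u} [Field k] {X : Scheme.{u}}
    (f : X ⟶ Spec (CommRingCat.of k)) (D : Set (Point f (AlgebraicClosure k))) : Prop :=
  ∀ 𝒱 : Set (Closeds X), 𝒱.Countable → (∀ V ∈ 𝒱, V ≠ ⊤) →
    ¬ ∀ x ∈ D, ∃ V ∈ 𝒱, x.support ∈ V

end LargeFieldVarieties

end

/-! Near a rational point, `X` has an affine open `Spec A` étale over affine space. Each proper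
closed subset is cut there by some `h ≠ 0`, which divides a nonzero polynomial `r h` because `A` is
algebraic over the polynomial ring. Fewer than `#k` polynomials are all nonzero at a common `u`;
join the image `c` of the given point to `u` by a line. No `r h` vanishes identically on it, so it
suffices that the set `T` of parameters that lift to rational points of `Spec A` has size `#k`. For
`a` in `k`, pull the cover back along `s ↦ c + s(u - c)` and `s ↦ c + as(u - c)`. The fibre product
over the `s`-line is an étale curve with a rational point over `0`, so largeness gives a rational
point over some `s ≠ 0`. Thus `s` and `as` lie in `T`, hence `T / T = k`, and `#T = #k` since `k` is
infinite. -/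

/-! ### Local structure and pushouts of étale algebras -/

/-- A Noetherian local ring whose maximal ideal is generated by a nonzerodivisor is a domain. -/
theorem IsLocalRing.isDomain_of_maximalIdeal_eq_span_singleton {R : Type*} [CommRing R]
    [IsLocalRing R] [IsNoetherianRing R] {s : R} (hs : s ∈ nonZeroDivisors R)
    (hm : IsLocalRing.maximalIdeal R = Ideal.span {s}) : IsDomain R := by
  have key : ∀ x : R, x ≠ 0 → ∃ (n : ℕ) (u : R), IsUnit u ∧ x = s ^ n * u := by
    intro x hx
    have h1 : ∃ n, x ∉ IsLocalRing.maximalIdeal R ^ n := by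
      by_contra! h
      apply hx
      have := Ideal.iInf_pow_eq_bot_of_isLocalRing (IsLocalRing.maximalIdeal R)
        (IsLocalRing.maximalIdeal.isMaximal R).ne_top
      rw [← Ideal.mem_bot, ← this]
      simpa using h
    classical
    obtain ⟨n, hn⟩ : ∃ n, Nat.find h1 = n + 1 :=
      Nat.exists_eq_succ_of_ne_zero fun h0 ↦ by simpa [h0] using Nat.find_spec h1
    have h2 : x ∈ IsLocalRing.maximalIdeal R ^ n :=
      not_not.mp (Nat.find_min h1 (m := n) (by lia))
    have h3 : x ∉ IsLocalRing.maximalIdeal R ^ (n + 1) := hn ▸ Nat.find_spec h1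
    rw [hm, Ideal.span_singleton_pow, Ideal.mem_span_singleton] at h2 h3
    obtain ⟨u, rfl⟩ := h2
    refine ⟨n, u, ?_, rfl⟩
    by_contra hu
    rw [← mem_nonunits_iff, ← IsLocalRing.mem_maximalIdeal, hm, Ideal.mem_span_singleton] at hu
    exact h3 (by rw [pow_succ]; exact mul_dvd_mul_left _ hu)
  have : NoZeroDivisors R := by
    refine ⟨fun {a b} hab ↦ ?_⟩
    by_contra! h
    obtain ⟨n, u, hu, rfl⟩ := key a h.1
    obtain ⟨m, v, hv, rfl⟩ := key b h.2
    have h1 : s ^ (n + m) * (u * v) = 0 := by rw [← hab]; ring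
    rw [(hu.mul hv).mul_left_eq_zero] at h1
    have h2 := pow_mem hs (n + m)
    rw [h1] at h2
    exact zero_notMem_nonZeroDivisors h2
  exact NoZeroDivisors.to_isDomain R

/-- The kernel of `B → B_p` is finitely generated, so a single `g ∉ p` kills it, and `B_g` inherits
the absence of zero divisors from `B_p`. -/
theorem Localization.exists_isDomain_away_of_isDomain_atPrime {B : Type*} [CommRing B]
    [IsNoetherianRing B] (p : Ideal B) [p.IsPrime] [IsDomain (Localization.AtPrime p)] :
    ∃ g ∉ p, IsDomain (Localization.Away g) := by
  let I := RingHom.ker (algebraMap B (Localization.AtPrime p))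
  have hI : ∀ x ∈ I, ∃ g ∉ p, g * x = 0 := by
    intro x hx
    obtain ⟨g, hg⟩ := (IsLocalization.map_eq_zero_iff p.primeCompl _ x).mp hx
    exact ⟨g, g.2, hg⟩
  obtain ⟨g, hgp, hg⟩ : ∃ g ∉ p, ∀ x ∈ I, g * x = 0 := by
    have h1 : (⟨p, inferInstance⟩ : PrimeSpectrum B) ∉ Module.support B I := by
      rw [Module.notMem_support_iff']
      rintro ⟨x, hx⟩
      obtain ⟨g, hg, h⟩ := hI x hx
      exact ⟨g, hg, Subtype.ext h⟩
    rw [Module.mem_support_iff_of_finite] at h1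
    obtain ⟨g, hg, hgp⟩ := SetLike.not_le_iff_exists.mp h1
    refine ⟨g, hgp, fun x hx ↦ ?_⟩
    simpa using congrArg Subtype.val (Module.mem_annihilator.mp hg ⟨x, hx⟩)
  refine ⟨g, hgp, ?_⟩
  have hz : ∀ a ∈ I, algebraMap B (Localization.Away g) a = 0 := fun a ha ↦
    (IsLocalization.map_eq_zero_iff (Submonoid.powers g) _ a).mpr
      ⟨⟨g, Submonoid.mem_powers g⟩, hg a ha⟩
  have : Nontrivial (Localization.Away g) := by
    rw [← not_subsingleton_iff_nontrivial, IsLocalization.subsingleton_iff (M := .powers g)]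
    rintro ⟨n, hn⟩
    exact hgp (Ideal.IsPrime.mem_of_pow_mem ‹_› n (by
      rw [show g ^ n = 0 from hn]; exact p.zero_mem))
  have : NoZeroDivisors (Localization.Away g) := by
    refine ⟨fun {x y} hxy ↦ ?_⟩
    obtain ⟨a, c, rfl⟩ := IsLocalization.exists_mk'_eq (Submonoid.powers g) x
    obtain ⟨b, d, rfl⟩ := IsLocalization.exists_mk'_eq (Submonoid.powers g) y
    rw [← IsLocalization.mk'_mul, IsLocalization.mk'_eq_zero_iff] at hxy
    obtain ⟨⟨_, n, rfl⟩, hn⟩ := hxy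
    have hab : algebraMap B (Localization.AtPrime p) (a * b) = 0 := by
      rw [IsLocalization.map_eq_zero_iff p.primeCompl]
      exact ⟨⟨g ^ n, fun h ↦ hgp (Ideal.IsPrime.mem_of_pow_mem ‹_› n h)⟩, hn⟩
    rw [map_mul, mul_eq_zero] at hab
    refine hab.imp (fun h ↦ ?_) (fun h ↦ ?_)
    · rw [IsLocalization.mk'_eq_mul_mk'_one, hz _ h, zero_mul]
    · rw [IsLocalization.mk'_eq_mul_mk'_one, hz _ h, zero_mul]
  exact NoZeroDivisors.to_isDomain _

open Polynomial in
/-- An étale `k[X]`-algebra is a domain locally around each rational point over `X = 0`. -/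
theorem Algebra.Etale.exists_isDomain_away_of_algHom {k B : Type*} [Field k] [CommRing B]
    [Algebra k B] [Algebra k[X] B] [IsScalarTower k k[X] B] [Algebra.Etale k[X] B]
    (φ : B →ₐ[k] k) (hφ : φ (algebraMap k[X] B X) = 0) :
    ∃ g : B, φ g ≠ 0 ∧ IsDomain (Localization.Away g) := by
  have : IsNoetherianRing B := Algebra.FiniteType.isNoetherianRing k[X] B
  let q : Ideal B := RingHom.ker φ
  have hq : q.IsPrime := RingHom.ker_isPrime _
  have hcomp : ∀ f : k[X], φ (algebraMap k[X] B f) = f.eval 0 := by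
    intro f
    have : (φ.comp (IsScalarTower.toAlgHom k k[X] B)) = Polynomial.aeval 0 := by
      ext; simpa using hφ
    simpa [Polynomial.coe_aeval_eq_eval] using congr($this f)
  let p : Ideal k[X] := Ideal.span {X}
  have hp : p.IsPrime := by
    rw [Ideal.span_singleton_prime X_ne_zero]; exact prime_X
  have : q.LiesOver p := ⟨by
    ext f
    rw [Ideal.mem_comap, RingHom.mem_ker, hcomp, Ideal.mem_span_singleton, X_dvd_iff,
      coeff_zero_eq_eval_zero]⟩
  let : Algebra (Localization.AtPrime p) (Localization.AtPrime q) :=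
    Localization.AtPrime.algebraOfLiesOver p q
  have hmax := ((Algebra.isUnramifiedAt_iff_map_eq k[X] p q).mp inferInstance).2
  -- Unramifiedness makes `X` generate the maximal ideal; flatness makes it a nonzerodivisor.
  rw [Ideal.map_span, Set.image_singleton] at hmax
  have hX : algebraMap k[X] (Localization.AtPrime q) X ∈ nonZeroDivisors _ := by
    have : Module.Flat k[X] (Localization.AtPrime q) := Module.Flat.trans _ B _
    have h := Module.Flat.isSMulRegular_of_nonZeroDivisors (M := Localization.AtPrime q)
      (mem_nonZeroDivisors_of_ne_zero (X_ne_zero (R := k)))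
    rw [mem_nonZeroDivisors_iff_right]
    intro z hz
    exact h.right_eq_zero_of_smul (by rw [Algebra.smul_def, mul_comm, hz])
  have := IsLocalRing.isDomain_of_maximalIdeal_eq_span_singleton hX hmax.symm
  exact Localization.exists_isDomain_away_of_isDomain_atPrime q

/-- Étale algebras have étale pushouts along arbitrary ring homomorphisms. -/
theorem Algebra.Etale.exists_isPushout {P A R : Type u} [CommRing P] [CommRing A] [CommRing R]
    [Algebra P A] [Algebra.Etale P A] (α : P →+* R) :
    ∃ (S : Type u) (_ : CommRing S) (_ : Algebra R S) (ι : A →+* S), Algebra.Etale R S ∧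
      ι.comp (algebraMap P A) = (algebraMap R S).comp α ∧
      ∀ {K : Type u} [CommRing K] (f : R →+* K) (g : A →+* K),
        f.comp α = g.comp (algebraMap P A) →
        ∃ h : S →+* K, h.comp (algebraMap R S) = f ∧ h.comp ι = g := by
  let := α.toAlgebra
  refine ⟨TensorProduct P R A, inferInstance, inferInstance,
    (Algebra.TensorProduct.includeRight : A →ₐ[P] TensorProduct P R A).toRingHom,
    inferInstance, ?_, ?_⟩
  · ext x
    exact (Algebra.TensorProduct.includeRight : A →ₐ[P] TensorProduct P R A).commutes x
  · intro K _ f g hfg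
    let := (f.comp α).toAlgebra
    let f' : R →ₐ[P] K := ⟨f, fun _ ↦ rfl⟩
    let g' : A →ₐ[P] K := ⟨g, fun r ↦ (congr($hfg r)).symm⟩
    refine ⟨(Algebra.TensorProduct.productMap f' g').toRingHom, ?_, ?_⟩
    · ext x
      simp [Algebra.TensorProduct.algebraMap_apply, f']
    · ext x
      simp [g']

/-! ### Rational points on étale curves over a large field -/

namespace LargeFieldVarieties

variable {k : Type u} [Field k]

theorem IsLargeField.exists_algHom_ne_zero (hk : IsLargeField k) {C : Type u} [CommRing C]
    [IsDomain C] [Algebra k C] [Algebra.Smooth k C] (φ : C →ₐ[k] k) {s : C} (hs : s ≠ 0) :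
    ∃ ψ : C →ₐ[k] k, ψ s ≠ 0 := by
  let g : Spec (CommRingCat.of C) ⟶ Spec (CommRingCat.of k) :=
    Spec.map (CommRingCat.ofHom (algebraMap k C))
  have hsm : Smooth g := by
    rw [HasRingHomProperty.Spec_iff (P := @Smooth)]
    exact RingHom.smooth_algebraMap.mpr inferInstance
  have hg : IsVariety g := ⟨inferInstance, inferInstance, inferInstance, inferInstance⟩
  have hd := hk _ g hg inferInstance
    ⟨⟨Spec.map (CommRingCat.ofHom φ.toRingHom), by
      rw [← Spec.map_comp, ← CommRingCat.ofHom_comp]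
      congr 2
      exact φ.comp_algebraMap⟩, ⊤, trivial, inferInstance⟩
  have hne : (PrimeSpectrum.basicOpen s : Set (PrimeSpectrum C)).Nonempty := by
    rw [Set.nonempty_iff_ne_empty]
    intro h
    have h' : PrimeSpectrum.basicOpen s = ⊥ := SetLike.coe_injective (by simpa using h)
    rw [PrimeSpectrum.basicOpen_eq_bot_iff] at h'
    exact hs (isNilpotent_iff_eq_zero.mp h')
  obtain ⟨_, hx, y, rfl⟩ := hd.inter_open_nonempty _ (PrimeSpectrum.basicOpen s).isOpen hne
  obtain ⟨ψ, hψ⟩ := Spec.map_surjective y.hom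
  have hψk : ψ.hom.comp (algebraMap k C) = algebraMap k k := by
    have h := y.hom_comp
    rw [← hψ, ← Spec.map_comp] at h
    exact congrArg CommRingCat.Hom.hom (Spec.map_injective h)
  refine ⟨⟨ψ.hom, fun r ↦ congr($hψk r)⟩, fun h0 ↦ ?_⟩
  replace hx : s ∉ (y.hom (IsLocalRing.closedPoint k)).asIdeal := hx
  rw [← hψ] at hx
  apply hx
  change ψ.hom s ∈ IsLocalRing.maximalIdeal k
  change ψ.hom s = 0 at h0
  rw [h0]
  exact zero_mem _

open Polynomial in
theorem IsLargeField.exists_algHom_algebraMap_X_ne_zero (hk : IsLargeField k) {B : Type u}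
    [CommRing B] [Algebra k B] [Algebra k[X] B] [IsScalarTower k k[X] B] [Algebra.Etale k[X] B]
    (φ : B →ₐ[k] k) (hφ : φ (algebraMap k[X] B X) = 0) :
    ∃ ψ : B →ₐ[k] k, ψ (algebraMap k[X] B X) ≠ 0 := by
  obtain ⟨g, hg, _⟩ := Algebra.Etale.exists_isDomain_away_of_algHom φ hφ
  have : Algebra.Smooth k k[X] := {}
  have : Algebra.Smooth k (Localization.Away g) := Algebra.Smooth.comp k k[X] _
  let φ' : Localization.Away g →ₐ[k] k :=
    IsLocalization.liftAlgHom (M := .powers g) (f := φ) (by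
      rintro ⟨_, n, rfl⟩
      simpa using (pow_ne_zero n hg))
  have hX : algebraMap k[X] (Localization.Away g) X ≠ 0 := by
    intro h0
    have h := Module.Flat.isSMulRegular_of_nonZeroDivisors (M := Localization.Away g)
      (mem_nonZeroDivisors_of_ne_zero (X_ne_zero (R := k)))
    exact one_ne_zero (h.right_eq_zero_of_smul (x := (1 : Localization.Away g))
      (by rw [Algebra.smul_def, h0, zero_mul]))
  obtain ⟨ψ, hψ⟩ := hk.exists_algHom_ne_zero φ' hX
  refine ⟨ψ.comp (IsScalarTower.toAlgHom k B _), ?_⟩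
  simpa [← IsScalarTower.algebraMap_apply] using hψ

open Polynomial in
/-- Two lines through the image of a rational point of an étale cover of `Spec P`, parametrised by
`α` and `β`, lift to rational points of the cover at a common nonzero parameter. -/
theorem IsLargeField.exists_algHom_pair (hk : IsLargeField k) {P A : Type u}
    [CommRing P] [CommRing A] [Algebra k P] [Algebra k A] [Algebra P A] [IsScalarTower k P A]
    [Algebra.Etale P A] (α β : P →ₐ[k] k[X]) (p₀ : A →ₐ[k] k)
    (hα : ∀ f, p₀ (algebraMap P A f) = (α f).eval 0)
    (hβ : ∀ f, p₀ (algebraMap P A f) = (β f).eval 0) :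
    ∃ s : k, s ≠ 0 ∧ (∃ p : A →ₐ[k] k, ∀ f, p (algebraMap P A f) = (α f).eval s) ∧
      ∃ q : A →ₐ[k] k, ∀ f, q (algebraMap P A f) = (β f).eval s := by
  obtain ⟨S, _, _, ι, _, hι, hS⟩ := Algebra.Etale.exists_isPushout (A := A) α.toRingHom
  -- Pushing out over `S` makes `Spec B` the fibre product of both pullbacks over the line.
  obtain ⟨B, _, _, κ, _, hκ, hB⟩ := Algebra.Etale.exists_isPushout (A := A)
    ((algebraMap k[X] S).comp β.toRingHom)
  let : Algebra k[X] B := ((algebraMap S B).comp (algebraMap k[X] S)).toAlgebra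
  have : IsScalarTower k[X] S B := .of_algebraMap_eq' rfl
  let : Algebra k B := ((algebraMap k[X] B).comp (algebraMap k k[X])).toAlgebra
  have : IsScalarTower k k[X] B := .of_algebraMap_eq' rfl
  have : Algebra.Etale k[X] B := Algebra.Etale.comp k[X] S B
  obtain ⟨φ₁, h₁, -⟩ := hS (evalRingHom 0) p₀.toRingHom (by ext f; exact (hα f).symm)
  obtain ⟨φ, h₂, -⟩ := hB φ₁ p₀.toRingHom (by
    rw [← RingHom.comp_assoc, h₁]; ext f; exact (hβ f).symm)
  have hφ : ∀ f : k[X], φ (algebraMap k[X] B f) = f.eval 0 := by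
    intro f
    rw [IsScalarTower.algebraMap_apply k[X] S B]
    exact (congr($h₂ _)).trans congr($h₁ f)
  obtain ⟨ψ, hψ⟩ := hk.exists_algHom_algebraMap_X_ne_zero
    (⟨φ, fun r ↦ (hφ (C r)).trans eval_C⟩ : B →ₐ[k] k) (by simpa using hφ X)
  let s := ψ (algebraMap k[X] B X)
  have hs : ∀ f : k[X], ψ (algebraMap k[X] B f) = f.eval s := by
    intro f
    have : ψ.comp (IsScalarTower.toAlgHom k k[X] B) = aeval s := by
      ext; simp [s]
    simpa [coe_aeval_eq_eval] using congr($this f)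
  have hp : ∀ f, ψ (algebraMap S B (ι (algebraMap P A f))) = (α f).eval s := by
    intro f
    rw [← hs, IsScalarTower.algebraMap_apply k[X] S B]
    exact congrArg (fun x ↦ ψ (algebraMap S B x)) congr($hι f)
  have hq : ∀ f, ψ (κ (algebraMap P A f)) = (β f).eval s := by
    intro f
    rw [← hs, IsScalarTower.algebraMap_apply k[X] S B]
    exact congrArg (fun x ↦ ψ x) congr($hκ f)
  refine ⟨s, hψ, ⟨⟨(ψ.toRingHom.comp (algebraMap S B)).comp ι, fun r ↦ ?_⟩, hp⟩,
    ⟨⟨ψ.toRingHom.comp κ, fun r ↦ ?_⟩, hq⟩⟩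
  · rw [IsScalarTower.algebraMap_apply k P A]
    refine (hp _).trans ?_
    simp
  · rw [IsScalarTower.algebraMap_apply k P A]
    refine (hq _).trans ?_
    simp

end LargeFieldVarieties

/-! ### Avoiding few hypersurfaces in affine space -/

open Polynomial in
theorem Polynomial.exists_mem_forall_eval_ne_zero {k : Type u} [Field k] [Infinite k] {T : Set k}
    (hT : #T = #k) {H : Set k[X]} (h0 : 0 ∉ H) (hH : #H < #k) :
    ∃ t ∈ T, ∀ Q ∈ H, Q.eval t ≠ 0 := by
  by_contra! h
  have hsub : T ⊆ ⋃ Q : H, {t | Q.1.IsRoot t} := by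
    intro t ht
    obtain ⟨Q, hQ, h⟩ := h t ht
    exact Set.mem_iUnion.mpr ⟨⟨Q, hQ⟩, h⟩
  have hfin : ∀ Q : H, {t | Q.1.IsRoot t}.Finite := fun Q ↦
    finite_setOfPred_isRoot fun h ↦ h0 (h ▸ Q.2)
  have hle : #k ≤ #(⋃ Q : H, {t | Q.1.IsRoot t} : Set k) := hT ▸ mk_le_mk_of_subset hsub
  refine absurd hle (not_le.mpr ?_)
  rcases lt_or_ge #H ℵ₀ with hlt | hge
  -- `k` may be countable, so finite `H` needs a separate count: the absorption `#H * ℵ₀ = #H`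
  -- requires `H` infinite.
  · have : Finite H := lt_aleph0_iff_finite.mp hlt
    exact (lt_aleph0_iff_set_finite.mpr (Set.finite_iUnion hfin)).trans_le (aleph0_le_mk k)
  · refine lt_of_le_of_lt ?_ hH
    refine (mk_iUnion_le _).trans ?_
    refine (mul_le_mul_right (ciSup_le' fun Q ↦ (hfin Q).lt_aleph0.le) _).trans ?_
    exact (mul_aleph0_eq hge).le

/-- Induction on `n`: keep the leading coefficients in one variable nonzero, then avoid the roots of
the resulting univariate polynomials. -/
theorem MvPolynomial.exists_forall_eval_ne_zero {k : Type u} [Field k] [Infinite k] {n : ℕ}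
    {H : Set (MvPolynomial (Fin n) k)} (h0 : 0 ∉ H) (hH : #H < #k) :
    ∃ u : Fin n → k, ∀ f ∈ H, eval u f ≠ 0 := by
  induction n with
  | zero =>
    refine ⟨0, fun f hf h ↦ h0 ?_⟩
    rw [eq_C_of_isEmpty f, eval_C] at h
    have hf0 : f = 0 := by rw [eq_C_of_isEmpty f, h, map_zero]
    exact hf0 ▸ hf
  | succ n ih =>
    obtain ⟨u, hu⟩ := ih (H := (fun f ↦ (finSuccEquiv k n f).leadingCoeff) '' H) (by
      rintro ⟨f, hf, h⟩
      rw [Polynomial.leadingCoeff_eq_zero, map_eq_zero_iff _ (finSuccEquiv k n).injective] at h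
      exact h0 (h ▸ hf)) (mk_image_le.trans_lt hH)
    obtain ⟨t, -, ht⟩ := Polynomial.exists_mem_forall_eval_ne_zero (T := Set.univ) mk_univ
      (H := (fun f ↦ (finSuccEquiv k n f).map (eval u)) '' H) (by
        rintro ⟨f, hf, h⟩
        refine hu _ ⟨f, hf, rfl⟩ ?_
        simpa using congrArg (Polynomial.coeff · (finSuccEquiv k n f).natDegree) h)
      (mk_image_le.trans_lt hH)
    refine ⟨Fin.cons t u, fun f hf ↦ ?_⟩
    rw [eval_eq_eval_mv_eval']
    exact ht _ ⟨f, hf, rfl⟩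

/-- By flatness `A` embeds in its base change to the fraction field of `P`, which is a finite
algebra. -/
theorem Algebra.Etale.isAlgebraic (P A : Type*) [CommRing P] [IsDomain P] [CommRing A]
    [Algebra P A] [Algebra.Etale P A] : Algebra.IsAlgebraic P A := by
  let K := FractionRing P
  have : Module.Finite K (TensorProduct P K A) := Algebra.FormallyUnramified.finite_of_free _ _
  refine ⟨fun a ↦ ?_⟩
  let ι : A →ₐ[P] TensorProduct P K A := Algebra.TensorProduct.includeRight
  have hι : Function.Injective ι :=
    Algebra.TensorProduct.includeRight_injective (IsFractionRing.injective P K)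
  rw [← isAlgebraic_algHom_iff ι hι, IsFractionRing.isAlgebraic_iff P K]
  exact (Algebra.IsIntegral.isIntegral (R := K) (ι a)).isAlgebraic

/-! ### Rational points of étale covers of affine space -/

namespace LargeFieldVarieties

variable {k : Type u} [Field k]

-- Over a finite field, `∏ (X - a)` would vanish at every rational point of the affine line.
open Polynomial in
theorem IsLargeField.infinite (hk : IsLargeField k) : Infinite k := by
  by_contra h
  rw [not_infinite_iff_finite] at h
  have := Fintype.ofFinite k
  have : Algebra.Smooth k k[X] := {}
  obtain ⟨ψ, hψ⟩ := hk.exists_algHom_ne_zero (aeval (R := k) (0 : k)) (s := ∏ a : k, (X - C a))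
    (Finset.prod_ne_zero_iff.mpr fun a _ ↦ X_sub_C_ne_zero a)
  refine hψ ?_
  rw [map_prod, Finset.prod_eq_zero (Finset.mem_univ (ψ X))]
  rw [map_sub, sub_eq_zero, ← algebraMap_eq, ψ.commutes, Algebra.algebraMap_self_apply]

/-- Over a large field, the rational points of an integral étale cover of affine space are not covered
by fewer than `#k` hypersurfaces. The parameters on a line whose points lift form a set `T` with
`T / T = k`, hence of cardinality `#k`. -/
theorem IsLargeField.exists_algHom_forall_ne_zero (hk : IsLargeField k) {n : ℕ} {A : Type u}
    [CommRing A] [IsDomain A] [Algebra k A] [Algebra (MvPolynomial (Fin n) k) A]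
    [IsScalarTower k (MvPolynomial (Fin n) k) A] [Algebra.Etale (MvPolynomial (Fin n) k) A]
    (p₀ : A →ₐ[k] k) {H : Set A} (h0 : 0 ∉ H) (hH : #H < #k) :
    ∃ p : A →ₐ[k] k, ∀ h ∈ H, p h ≠ 0 := by
  have := hk.infinite
  have := Algebra.Etale.isAlgebraic (MvPolynomial (Fin n) k) A
  have hr : ∀ h : A, ∃ r : MvPolynomial (Fin n) k, h ∈ H →
      r ≠ 0 ∧ h ∣ algebraMap (MvPolynomial (Fin n) k) A r := by
    intro h
    by_cases hh : h ∈ H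
    · obtain ⟨r, hr⟩ := (Algebra.IsAlgebraic.isAlgebraic (R := MvPolynomial (Fin n) k)
        h).exists_nonzero_dvd (mem_nonZeroDivisors_of_ne_zero fun h1 ↦ h0 (h1 ▸ hh))
      exact ⟨r, fun _ ↦ hr⟩
    · exact ⟨0, fun h ↦ absurd h hh⟩
  choose r hr using hr
  obtain ⟨u, hu⟩ := MvPolynomial.exists_forall_eval_ne_zero (H := r '' H) (by
    rintro ⟨h, hh, h1⟩
    exact (hr h hh).1 h1) (mk_image_le.trans_lt hH)
  let c : Fin n → k := fun i ↦ p₀ (algebraMap (MvPolynomial (Fin n) k) A (MvPolynomial.X i))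
  let γ (a : k) : MvPolynomial (Fin n) k →ₐ[k] Polynomial k :=
    MvPolynomial.aeval fun i ↦ .C (c i) + .C (a * (u i - c i)) * .X
  have hγ : ∀ a s f, (γ a f).eval s =
      MvPolynomial.eval (fun i ↦ c i + a * (u i - c i) * s) f := by
    intro a s f
    have : (Polynomial.aeval (R := k) s).comp (γ a) =
        MvPolynomial.aeval (fun i ↦ c i + a * (u i - c i) * s) := by
      ext; simp [γ]
    simpa [Polynomial.coe_aeval_eq_eval, MvPolynomial.coe_aeval_eq_eval] using congr($this f)
  have hp₀ : ∀ f, p₀ (algebraMap (MvPolynomial (Fin n) k) A f) = MvPolynomial.eval c f := by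
    intro f
    have : p₀.comp (IsScalarTower.toAlgHom k (MvPolynomial (Fin n) k) A) = MvPolynomial.aeval c := by
      ext; simp [c]
    simpa [MvPolynomial.coe_aeval_eq_eval] using congr($this f)
  let T : Set k := {s | ∃ p : A →ₐ[k] k, ∀ f, p (algebraMap (MvPolynomial (Fin n) k) A f) =
    (γ 1 f).eval s}
  have hT : ∀ a : k, ∃ x : T × T, x.1.1 / x.2.1 = a := by
    intro a
    obtain ⟨s, hs, hp, q, hq⟩ := hk.exists_algHom_pair (γ 1) (γ a) p₀
      (by simp [hγ, hp₀]) (by simp [hγ, hp₀])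
    -- `γ a` at `s` is `γ 1` at `a * s`.
    refine ⟨⟨⟨a * s, q, fun f ↦ ?_⟩, s, hp⟩, mul_div_cancel_right₀ a hs⟩
    rw [hq, hγ, hγ]
    congr 2
    ext i
    ring
  have hTk : #T = #k := by
    refine le_antisymm (mk_set_le T) ?_
    have hle : #k ≤ #T * #T := by
      rw [mul_def]
      exact mk_le_of_surjective hT
    have hinf : ℵ₀ ≤ #T := by
      by_contra! hlt
      exact absurd ((aleph0_le_mk k).trans hle) (not_le.mpr (mul_lt_aleph0 hlt hlt))
    rwa [mul_eq_self hinf] at hle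
  obtain ⟨s, ⟨p, hp⟩, hs⟩ := Polynomial.exists_mem_forall_eval_ne_zero hTk
    (H := (fun h ↦ γ 1 (r h)) '' H) (by
      -- At parameter `1` the line passes through `u`, where `r h` is nonzero.
      rintro ⟨h, hh, h1⟩
      refine hu _ ⟨h, hh, rfl⟩ ?_
      have := hγ 1 1 (r h)
      rw [show γ 1 (r h) = 0 from h1] at this
      simpa using this.symm) (mk_image_le.trans_lt hH)
  refine ⟨p, fun h hh h1 ↦ hs _ ⟨h, hh, rfl⟩ ?_⟩
  have := map_dvd p (hr h hh).2
  rwa [h1, zero_dvd_iff, hp] at this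

end LargeFieldVarieties

theorem PrimeSpectrum.exists_ne_zero_of_isClosed_of_ne_univ {A : Type*} [CommRing A] [IsDomain A]
    (Z : Set (PrimeSpectrum A)) (hZ : IsClosed Z) (hne : Z ≠ Set.univ) :
    ∃ h : A, h ≠ 0 ∧ ∀ x ∈ Z, h ∈ x.asIdeal := by
  obtain ⟨s, rfl⟩ := (PrimeSpectrum.isClosed_iff_zeroLocus Z).mp hZ
  obtain ⟨h, hs, h0⟩ : ∃ h ∈ s, h ≠ 0 := by
    by_contra! hs
    exact hne (Set.eq_univ_of_forall fun x f hf ↦ by simp [hs f hf])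
  exact ⟨h, h0, fun x hx ↦ hx hs⟩

/-! ### Passage from schemes to étale coordinates -/

namespace LargeFieldVarieties

variable {k : Type u} [Field k]

theorem Point.support_baseChange {X : Scheme.{u}} {f : X ⟶ Spec (CommRingCat.of k)}
    (x : Point f k) (K : Type u) [Field K] [Algebra k K] :
    (x.baseChange K).support = x.support := by
  change x.hom _ = x.hom _
  exact congrArg x.hom (Subsingleton.elim (α := PrimeSpectrum k) _ _)

theorem exists_standardSmooth_affineOpen {X : Scheme.{u}} (f : X ⟶ Spec (CommRingCat.of k))
    [Smooth f] (x : X) :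
    ∃ V : X.Opens, ∃ hV : IsAffineOpen V, x ∈ V ∧ ∃ φ : CommRingCat.of k ⟶ Γ(X, V),
      hV.fromSpec ≫ f = Spec.map φ ∧ φ.hom.IsStandardSmooth := by
  obtain ⟨U, hU, V, hV, hx, e, hs⟩ := Smooth.exists_isStandardSmooth f x
  obtain rfl : U = ⊤ := by
    refine eq_top_iff.mpr fun y _ ↦ ?_
    rw [show y = f x from Subsingleton.elim (α := PrimeSpectrum k) _ _]
    exact e hx
  refine ⟨V, hV, hx, (Scheme.ΓSpecIso (CommRingCat.of k)).inv ≫ f.appLE ⊤ V e, ?_, ?_⟩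
  · rw [Spec.map_comp, ← IsAffineOpen.SpecMap_appLE_fromSpec f hU hV e]
    congr 1
    rw [IsAffineOpen.fromSpec_top, Scheme.isoSpec_Spec_inv]
  · exact RingHom.IsStandardSmooth.comp hs
      (RingHom.IsStandardSmoothOfRelativeDimension.equiv
        (Scheme.ΓSpecIso (CommRingCat.of k)).symm.commRingCatIsoToRingEquiv).isStandardSmooth

theorem IsLargeField.exists_point_forall_notMem (hk : IsLargeField k) {X : Scheme.{u}}
    (f : X ⟶ Spec (CommRingCat.of k)) [IsIntegral X] [Smooth f] (x : Point f k)
    {𝒱 : Set (Closeds X)} (hne : ∀ V ∈ 𝒱, V ≠ ⊤) (hcard : #𝒱 < #k) :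
    ∃ y : Point f k, ∀ V ∈ 𝒱, y.support ∉ V := by
  obtain ⟨U, hU, hxU, φ, hφ, hsm⟩ := exists_standardSmooth_affineOpen f x.support
  have : Nonempty U := ⟨⟨_, hxU⟩⟩
  obtain ⟨n, g, hg, het⟩ := hsm.exists_etale_mvPolynomial
  let A : Type u := Γ(X, U)
  have : IsDomain A := inferInstanceAs (IsDomain Γ(X, U))
  let : Algebra k A := φ.hom.toAlgebra
  let : Algebra (MvPolynomial (Fin n) k) A := g.toAlgebra
  have : IsScalarTower k (MvPolynomial (Fin n) k) A := .of_algebraMap_eq' hg.symm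
  have : Algebra.Etale (MvPolynomial (Fin n) k) A := het
  have hrange : Set.range x.hom ⊆ Set.range hU.fromSpec := by
    rintro _ ⟨y, rfl⟩
    rw [hU.range_fromSpec, show y = IsLocalRing.closedPoint k from
      Subsingleton.elim (α := PrimeSpectrum k) _ _]
    exact hxU
  obtain ⟨π, hπ⟩ := Spec.map_surjective (IsOpenImmersion.lift hU.fromSpec x.hom hrange)
  have hφπ : φ ≫ π = 𝟙 _ := by
    apply Spec.map_injective
    rw [Spec.map_comp, hπ, ← hφ, IsOpenImmersion.lift_fac_assoc, x.hom_comp]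
    rfl
  let p₀ : A →ₐ[k] k := ⟨π.hom, fun r ↦ congr($(hφπ).hom r)⟩
  have hV : ∀ V : Closeds X, ∃ h : A, V ∈ 𝒱 → h ≠ 0 ∧
      ∀ z : PrimeSpectrum A, hU.fromSpec z ∈ V → h ∈ z.asIdeal := by
    intro V
    by_cases hVm : V ∈ 𝒱
    · obtain ⟨h, hh⟩ := PrimeSpectrum.exists_ne_zero_of_isClosed_of_ne_univ (A := A)
        (hU.fromSpec ⁻¹' V) (V.isClosed.preimage hU.fromSpec.continuous) (by
          intro huniv
          have hsub : (U : Set X) ⊆ V := by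
            rw [← hU.range_fromSpec]
            rintro _ ⟨z, rfl⟩
            exact huniv.ge (Set.mem_univ z)
          -- By irreducibility, a closed set containing `U` is all of `X`.
          have hd : Dense (U : Set X) := U.isOpen.dense ⟨_, hxU⟩
          refine hne V hVm (SetLike.coe_injective ?_)
          exact V.isClosed.closure_eq.symm.trans (hd.mono hsub).closure_eq)
      exact ⟨h, fun _ ↦ hh⟩
    · exact ⟨0, fun h ↦ absurd h hVm⟩
  choose h hh using hV
  obtain ⟨p, hp⟩ := hk.exists_algHom_forall_ne_zero (n := n) p₀ (H := h '' 𝒱) (by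
    rintro ⟨V, hV, h0⟩
    exact (hh V hV).1 h0) (mk_image_le.trans_lt hcard)
  refine ⟨⟨Spec.map (CommRingCat.ofHom p.toRingHom) ≫ hU.fromSpec, ?_⟩, fun V hV hm ↦ ?_⟩
  · rw [Category.assoc, hφ, ← Spec.map_comp]
    congr 1
    ext r
    exact p.commutes r
  · refine hp _ ⟨V, hV, rfl⟩ ?_
    have hmem := (hh V hV).2 (Spec.map (CommRingCat.ofHom p.toRingHom) (IsLocalRing.closedPoint k)) hm
    change p (h V) ∈ IsLocalRing.maximalIdeal k at hmem
    rwa [IsLocalRing.maximalIdeal_eq_bot, Ideal.mem_bot] at hmem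

end LargeFieldVarieties

theorem mainTheorem6 (k : Type u) [Field k] (hk : LargeFieldVarieties.IsLargeField k)
    (X : Scheme.{u}) (f : X ⟶ Spec (CommRingCat.of k)) (hX : LargeFieldVarieties.IsVariety f)
    (hirr : IrreducibleSpace X) (hsm : Smooth f) (hpt : Nonempty (LargeFieldVarieties.Point f k)) :
    (∀ 𝒱 : Set (Closeds X), (∀ V ∈ 𝒱, V ≠ ⊤) → #𝒱 < #k →
        ¬ ∀ x : LargeFieldVarieties.Point f k, ∃ V ∈ 𝒱, x.support ∈ V) ∧
      (Uncountable k → LargeFieldVarieties.IsZariskiVeryDense f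
        (Set.range fun x : LargeFieldVarieties.Point f k =>
          x.baseChange (AlgebraicClosure k))) := by
  have := hX.isReduced
  have := isIntegral_of_irreducibleSpace_of_isReduced X
  have main : ∀ 𝒱 : Set (Closeds X), (∀ V ∈ 𝒱, V ≠ ⊤) → #𝒱 < #k →
      ¬ ∀ x : LargeFieldVarieties.Point f k, ∃ V ∈ 𝒱, x.support ∈ V := by
    intro 𝒱 hne hcard hall
    obtain ⟨y, hy⟩ := hk.exists_point_forall_notMem f hpt.some hne hcard
    obtain ⟨V, hV, hyV⟩ := hall y
    exact hy V hV hyV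
  refine ⟨main, fun hunc 𝒱 hcount hne hall ↦ main 𝒱 hne ?_ fun x ↦ ?_⟩
  · exact (Cardinal.le_aleph0_iff_set_countable.mpr hcount).trans_lt
      (Cardinal.aleph0_lt_mk_iff.mpr hunc)
  · obtain ⟨V, hV, hx⟩ := hall _ ⟨x, rfl⟩
    exact ⟨V, hV, x.support_baseChange (AlgebraicClosure k) ▸ hx⟩
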